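/- Consider the pure untyped call-by-value $\lambda$-calculus of Plotkin: terms $t,u ::= v \mid tu$ and values $v ::= x \mid \lambda x.t$, up to $\alpha$-conversion. Balanced contexts are $B ::= \langle\cdot\rangle \mid (\lambda x.B)t \mid Bt \mid tB$, and balanced $\beta_v$-reduction $\to_{\beta_v^\flat}$ is the closure under balanced contexts (with capture-allowing filling of the hole) of the rule $(\lambda x.t)v \mapsto t\{v/x\}$, $v$ a value. Let $t$ be a closed term that is normalizable for $\to_{\beta_v^\flat}$, i.e. $t \to_{\beta_v^\flat}^* u$ for some $u$ from which no $\to_{\beta_v^\flat}$-step starts. Then $t$ has exactly one $\to_{\beta_v^\flat}$-normal form $t_0$, and any two $\to_{\beta_v^\flat}$-reduction sequences $d, d' \colon t \to_{\beta_v^\flat}^* t_0$ have the same length, that is, the same number of $\beta_v^\flat$-steps. -/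

import Mathlib

namespace CbV

/-- Untyped `λ`-terms up to `α`-conversion, in de Bruijn notation: under `k` abstractions the
indices `0, …, k - 1` are bound and the index `k + n` is the `n`-th free variable. -/
inductive Term : Type where
  | var : ℕ → Term
  | lam : Term → Term
  | app : Term → Term → Term

namespace Term

/-- The set of free variables. -/
def fv : Term → Set ℕ
  | var n => {n}
  | lam t => {n | n + 1 ∈ fv t}
  | app t u => fv t ∪ fv u

/-- A term is closed if it has no free variable. -/
def Closed (t : Term) : Prop := t.fv = ∅

/-- Values are the variables and the abstractions. -/
inductive IsValue : Term → Prop where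
  | var (n : ℕ) : IsValue (var n)
  | lam (t : Term) : IsValue (lam t)

/-- A renaming of the free variables, pushed under one abstraction. -/
def upRen (ρ : ℕ → ℕ) : ℕ → ℕ
  | 0 => 0
  | n + 1 => ρ n + 1

/-- Renaming of the free variables of a term. -/
def rename (ρ : ℕ → ℕ) : Term → Term
  | var n => var (ρ n)
  | lam t => lam (rename (upRen ρ) t)
  | app t u => app (rename ρ t) (rename ρ u)

/-- A substitution, pushed under one abstraction (the free variables of the substituted
terms are shifted, so that none of them is captured). -/
def up (σ : ℕ → Term) : ℕ → Term
  | 0 => var 0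
  | n + 1 => rename Nat.succ (σ n)

/-- Simultaneous capture-avoiding substitution. -/
def subst (σ : ℕ → Term) : Term → Term
  | var n => σ n
  | lam t => lam (subst (up σ) t)
  | app t u => app (subst σ t) (subst σ u)

/-- The substitution that sends the variable `0` to `v` and lowers the other variables. -/
def single (v : Term) : ℕ → Term
  | 0 => v
  | n + 1 => var n

/-- `t.inst v` is `t{v/x}`, where `t` is the body of an abstraction over `x`. -/
def inst (t v : Term) : Term := subst (single v) t

end Term

/-- The root-step `(λx.t)v ↦ t{v/x}`, for `v` a value. -/
inductive RootBetaV : Term → Term → Prop where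
  | beta (t v : Term) (hv : v.IsValue) : RootBetaV (Term.app (Term.lam t) v) (t.inst v)

/-- Balanced (one-hole) contexts: `B ::= ⟨·⟩ | (λx.B)t | Bt | tB`. -/
inductive BalancedCtx : Type where
  | hole : BalancedCtx
  | lamApp : BalancedCtx → Term → BalancedCtx
  | appL : BalancedCtx → Term → BalancedCtx
  | appR : Term → BalancedCtx → BalancedCtx

/-- `B.plug t` is `B⟨t⟩`, the result of filling the hole of `B` with `t`. The term `t` is not
shifted: its variables may be captured by the abstractions of `B`. -/
def BalancedCtx.plug : BalancedCtx → Term → Term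
  | hole, t => t
  | lamApp B s, t => Term.app (Term.lam (B.plug t)) s
  | appL B s, t => Term.app (B.plug t) s
  | appR s B, t => Term.app s (B.plug t)

/-- The closure of a root-step under balanced contexts. -/
def BalancedClosure (r : Term → Term → Prop) (t u : Term) : Prop :=
  ∃ (B : BalancedCtx) (t' u' : Term), t = B.plug t' ∧ u = B.plug u' ∧ r t' u'

/-- Balanced `β_v`-reduction. -/
def BalBetaV : Term → Term → Prop := BalancedClosure RootBetaV

/-- `RedSeq r t u` is the type of (finite) `r`-reduction sequences from `t` to `u`. -/
inductive RedSeq {α : Type} (r : α → α → Prop) : α → α → Type where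
  | nil (t : α) : RedSeq r t t
  | cons {t u s : α} (h : r t u) (d : RedSeq r u s) : RedSeq r t s

/-- The length (number of steps) of a reduction sequence. -/
def RedSeq.length {α : Type} {r : α → α → Prop} : {t u : α} → RedSeq r t u → ℕ
  | _, _, .nil _ => 0
  | _, _, .cons _ d => d.length + 1

/-- A term is `r`-normal if it has no `r`-reduct. -/
def Normal {α : Type} (r : α → α → Prop) (t : α) : Prop := ¬ ∃ u, r t u

/-- `u` is an `r`-normal form of `t`. -/
def IsNormalFormOf {α : Type} (r : α → α → Prop) (u t : α) : Prop :=
  Normal r u ∧ Relation.ReflTransGen r t u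

/-- A term is `r`-normalizable if it has an `r`-normal form. -/
def Normalizable {α : Type} (r : α → α → Prop) (t : α) : Prop :=
  ∃ u, IsNormalFormOf r u t

end CbV

namespace CbV

namespace Term

/-! Balanced contexts enter an abstraction only if it is applied, so values are normal. The argument
fired by a `β_v`-step thus contains no redex that substitution could duplicate or erase, and two
distinct one-step reducts join in exactly one step each (`quasiDiamond_balStep`). Such a relation
has random descent: every reduction to a normal form has the same length and the same end
(`QuasiDiamond.eq_and_length_eq`). -/

theorem rename_congr {ρ ρ' : ℕ → ℕ} (h : ∀ n, ρ n = ρ' n) (t : Term) :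
    t.rename ρ = t.rename ρ' := by rw [funext h]

theorem subst_congr {σ τ : ℕ → Term} (h : ∀ n, σ n = τ n) (t : Term) :
    t.subst σ = t.subst τ := by rw [funext h]

theorem rename_rename (ρ ρ' : ℕ → ℕ) (t : Term) :
    (t.rename ρ).rename ρ' = t.rename (fun n => ρ' (ρ n)) := by
  induction t generalizing ρ ρ' with
  | var n => rfl
  | lam t ih =>
    simp only [rename, ih]
    exact congrArg lam (rename_congr (fun n => by cases n <;> rfl) t)
  | app t u iht ihu => simp only [rename, iht, ihu]

theorem subst_rename (ρ : ℕ → ℕ) (σ : ℕ → Term) (t : Term) :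
    (t.rename ρ).subst σ = t.subst (fun n => σ (ρ n)) := by
  induction t generalizing ρ σ with
  | var n => rfl
  | lam t ih =>
    simp only [rename, subst, ih]
    exact congrArg lam (subst_congr (fun n => by cases n <;> rfl) t)
  | app t u iht ihu => simp only [rename, subst, iht, ihu]

theorem rename_subst (σ : ℕ → Term) (ρ : ℕ → ℕ) (t : Term) :
    (t.subst σ).rename ρ = t.subst (fun n => (σ n).rename ρ) := by
  induction t generalizing ρ σ with
  | var n => rfl
  | lam t ih =>
    simp only [rename, subst, ih]
    refine congrArg lam (subst_congr (fun n => ?_) t)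
    cases n with
    | zero => rfl
    | succ n => simp only [up, rename_rename, upRen, Nat.succ_eq_add_one]
  | app t u iht ihu => simp only [rename, subst, iht, ihu]

theorem subst_subst (σ τ : ℕ → Term) (t : Term) :
    (t.subst σ).subst τ = t.subst (fun n => (σ n).subst τ) := by
  induction t generalizing σ τ with
  | var n => rfl
  | lam t ih =>
    simp only [subst, ih]
    refine congrArg lam (subst_congr (fun n => ?_) t)
    cases n with
    | zero => rfl
    | succ n => simp only [up, subst_rename, rename_subst]
  | app t u iht ihu => simp only [subst, iht, ihu]

theorem subst_var (t : Term) : t.subst var = t := by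
  induction t with
  | var n => rfl
  | lam t ih =>
    have h : up var = var := funext fun n => by cases n <;> rfl
    rw [subst, h, ih]
  | app t u iht ihu => rw [subst, iht, ihu]

theorem subst_inst (σ : ℕ → Term) (t v : Term) :
    (t.inst v).subst σ = (t.subst (up σ)).inst (v.subst σ) := by
  simp only [inst, subst_subst]
  refine subst_congr (fun n => ?_) t
  cases n with
  | zero => rfl
  | succ n => simp only [up, single, subst, subst_rename, subst_var]

theorem IsValue.rename {v : Term} (hv : v.IsValue) (ρ : ℕ → ℕ) : (v.rename ρ).IsValue := by
  cases hv <;> constructor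

theorem IsValue.subst {v : Term} (hv : v.IsValue) {σ : ℕ → Term} (hσ : ∀ n, (σ n).IsValue) :
    (v.subst σ).IsValue := by
  cases hv with
  | var n => exact hσ n
  | lam t => exact .lam _

theorem isValue_up {σ : ℕ → Term} (hσ : ∀ n, (σ n).IsValue) (n : ℕ) : (up σ n).IsValue := by
  cases n with
  | zero => exact .var 0
  | succ n => exact (hσ n).rename _

theorem isValue_single {v : Term} (hv : v.IsValue) (n : ℕ) : (single v n).IsValue := by
  cases n with
  | zero => exact hv
  | succ n => exact .var n

end Term

open Term

/-- Inductive presentation of balanced `β_v`-reduction. -/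
inductive BalStep : Term → Term → Prop where
  | beta {t v : Term} (hv : v.IsValue) : BalStep (app (lam t) v) (t.inst v)
  | lamApp {t t' s : Term} (h : BalStep t t') : BalStep (app (lam t) s) (app (lam t') s)
  | appL {t t' s : Term} (h : BalStep t t') : BalStep (app t s) (app t' s)
  | appR {t s s' : Term} (h : BalStep s s') : BalStep (app t s) (app t s')

theorem balBetaV_iff_balStep {t u : Term} : BalBetaV t u ↔ BalStep t u := by
  constructor
  · rintro ⟨B, t', u', rfl, rfl, ⟨t, v, hv⟩⟩
    induction B with
    | hole => exact .beta hv
    | lamApp B s ih => exact .lamApp ih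
    | appL B s ih => exact .appL ih
    | appR s B ih => exact .appR ih
  · intro h
    induction h with
    | beta hv => exact ⟨.hole, _, _, rfl, rfl, .beta _ _ hv⟩
    | lamApp _ ih =>
      obtain ⟨B, t', u', rfl, rfl, hr⟩ := ih
      exact ⟨.lamApp B _, t', u', rfl, rfl, hr⟩
    | appL _ ih =>
      obtain ⟨B, t', u', rfl, rfl, hr⟩ := ih
      exact ⟨.appL B _, t', u', rfl, rfl, hr⟩
    | appR _ ih =>
      obtain ⟨B, t', u', rfl, rfl, hr⟩ := ih
      exact ⟨.appR _ B, t', u', rfl, rfl, hr⟩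

theorem Term.IsValue.not_balStep {v u : Term} (hv : v.IsValue) : ¬ BalStep v u := by
  intro h
  cases hv <;> cases h

/-- Substituting values matters: a redex argument may be a variable, and it must remain a value. -/
theorem BalStep.subst {t u : Term} (h : BalStep t u) {σ : ℕ → Term}
    (hσ : ∀ n, (σ n).IsValue) : BalStep (t.subst σ) (u.subst σ) := by
  induction h generalizing σ with
  | beta hv => rw [subst_inst]; exact .beta (hv.subst hσ)
  | lamApp _ ih => exact .lamApp (ih (isValue_up hσ))
  | appL _ ih => exact .appL (ih hσ)
  | appR _ ih => exact .appR (ih hσ)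

theorem BalStep.inst {t u v : Term} (h : BalStep t u) (hv : v.IsValue) :
    BalStep (t.inst v) (u.inst v) :=
  h.subst (isValue_single hv)

/-- Two distinct one-step reducts of the same term are joinable by one step on each side. -/
def QuasiDiamond {α : Type} (r : α → α → Prop) : Prop :=
  ∀ ⦃t u₁ u₂ : α⦄, r t u₁ → r t u₂ → u₁ = u₂ ∨ ∃ s, r u₁ s ∧ r u₂ s

/-- The only critical overlap is a root step against a step in the body of the applied abstraction,
which survives instantiation by a value. Steps in disjoint subterms commute. -/
theorem quasiDiamond_balStep : QuasiDiamond BalStep := by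
  intro t u₁ u₂ h₁ h₂
  induction h₁ generalizing u₂ with
  | beta hv =>
    cases h₂ with
    | beta => exact .inl rfl
    | lamApp h => exact .inr ⟨_, h.inst hv, .beta hv⟩
    | appL h => exact ((IsValue.lam _).not_balStep h).elim
    | appR h => exact (hv.not_balStep h).elim
  | lamApp h₁ ih =>
    cases h₂ with
    | beta hv => exact .inr ⟨_, .beta hv, h₁.inst hv⟩
    | lamApp h =>
      rcases ih h with rfl | ⟨s, hs₁, hs₂⟩
      · exact .inl rfl
      · exact .inr ⟨_, .lamApp hs₁, .lamApp hs₂⟩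
    | appL h => exact ((IsValue.lam _).not_balStep h).elim
    | appR h => exact .inr ⟨_, .appR h, .lamApp h₁⟩
  | appL h₁ ih =>
    cases h₂ with
    | beta => exact ((IsValue.lam _).not_balStep h₁).elim
    | lamApp => exact ((IsValue.lam _).not_balStep h₁).elim
    | appL h =>
      rcases ih h with rfl | ⟨s, hs₁, hs₂⟩
      · exact .inl rfl
      · exact .inr ⟨_, .appL hs₁, .appL hs₂⟩
    | appR h => exact .inr ⟨_, .appR h, .appL h₁⟩
  | appR h₁ ih =>
    cases h₂ with
    | beta hv => exact (hv.not_balStep h₁).elim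
    | lamApp h => exact .inr ⟨_, .lamApp h, .appR h₁⟩
    | appL h => exact .inr ⟨_, .appL h, .appR h₁⟩
    | appR h =>
      rcases ih h with rfl | ⟨s, hs₁, hs₂⟩
      · exact .inl rfl
      · exact .inr ⟨_, .appR hs₁, .appR hs₂⟩

theorem quasiDiamond_balBetaV : QuasiDiamond BalBetaV := by
  have h : BalBetaV = BalStep := by
    ext t u
    exact balBetaV_iff_balStep
  rw [h]
  exact quasiDiamond_balStep

section RandomDescent

variable {α : Type} {r : α → α → Prop}

theorem RedSeq.nonempty_of_reflTransGen {t u : α} (h : Relation.ReflTransGen r t u) :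
    Nonempty (RedSeq r t u) := by
  induction h using Relation.ReflTransGen.head_induction_on with
  | refl => exact ⟨.nil _⟩
  | head h _ ih => exact ih.map (.cons h)

theorem QuasiDiamond.exists_redSeq_of_step (hr : QuasiDiamond r) {t t₀ : α} (ht₀ : Normal r t₀)
    (d : RedSeq r t t₀) : ∀ {u : α}, r t u → ∃ e : RedSeq r u t₀, e.length + 1 = d.length := by
  induction d with
  | nil t => exact fun h => (ht₀ ⟨_, h⟩).elim
  | cons h d ih =>
    intro u hu
    rcases hr h hu with rfl | ⟨s, hs₁, hs₂⟩
    · exact ⟨d, rfl⟩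
    · obtain ⟨e, he⟩ := ih ht₀ hs₁
      exact ⟨.cons hs₂ e, congrArg (· + 1) he⟩

theorem QuasiDiamond.exists_redSeq_of_redSeq (hr : QuasiDiamond r) {t t₀ u : α}
    (ht₀ : Normal r t₀) (d : RedSeq r t t₀) (d' : RedSeq r t u) :
    ∃ e : RedSeq r u t₀, d'.length + e.length = d.length := by
  induction d' with
  | nil t => exact ⟨d, Nat.zero_add _⟩
  | cons h d' ih =>
    obtain ⟨e, he⟩ := hr.exists_redSeq_of_step ht₀ d h
    obtain ⟨e', he'⟩ := ih e
    refine ⟨e', ?_⟩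
    simp only [RedSeq.length]
    omega

theorem QuasiDiamond.eq_and_length_eq (hr : QuasiDiamond r) {t t₀ t₁ : α}
    (ht₀ : Normal r t₀) (ht₁ : Normal r t₁) (d : RedSeq r t t₀) (d' : RedSeq r t t₁) :
    t₁ = t₀ ∧ d'.length = d.length := by
  obtain ⟨e, he⟩ := hr.exists_redSeq_of_redSeq ht₀ d d'
  -- The residual path `e` starts at the normal term `t₁`, so it is empty.
  cases e with
  | nil => exact ⟨rfl, he⟩
  | cons h => exact (ht₁ ⟨_, h⟩).elim

end RandomDescent

end CbV

/-- A closed term that is normalizable for balanced `β_v`-reduction has exactly one normal form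
`t₀`, and all balanced `β_v`-reduction sequences from it to `t₀` have the same length. -/
theorem mainTheorem8 (t : CbV.Term) (hclosed : t.Closed)
    (hnorm : CbV.Normalizable CbV.BalBetaV t) :
    ∃ t₀ : CbV.Term, CbV.IsNormalFormOf CbV.BalBetaV t₀ t ∧
      (∀ t₁ : CbV.Term, CbV.IsNormalFormOf CbV.BalBetaV t₁ t → t₁ = t₀) ∧
      ∀ d d' : CbV.RedSeq CbV.BalBetaV t t₀, d.length = d'.length := by
  obtain ⟨t₀, hn, hred⟩ := hnorm
  obtain ⟨d⟩ := CbV.RedSeq.nonempty_of_reflTransGen hred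
  refine ⟨t₀, ⟨hn, hred⟩, fun t₁ ⟨hn₁, hred₁⟩ => ?_, fun d₁ d₂ =>
    (CbV.quasiDiamond_balBetaV.eq_and_length_eq hn hn d₂ d₁).2⟩
  obtain ⟨d₁⟩ := CbV.RedSeq.nonempty_of_reflTransGen hred₁
  exact (CbV.quasiDiamond_balBetaV.eq_and_length_eq hn hn₁ d d₁).1
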